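/- Let $\mathcal{B}$ (behavior profiles) and $\mathcal{H}$ (signals) be finite sets, $\mathcal{U}$ a measurable space of users with a probability law $\nu$, $\mathcal{A}$ a set of mechanisms, $sig:\mathcal{A}\times\mathcal{B}\times\mathcal{U}\to\mathcal{H}$ the signal function (measurable in the user), $a_0\in\mathcal{A}$ a fixed mechanism, and $M^*=(M^*_h)_{h\in\mathcal{H}}$ a family of $\mathcal{B}\times\mathcal{B}$ stochastic matrices (the true behavior model). Users $u_1,u_2,\dots$ are i.i.d. with law $\nu$, each $u_t$ being independent of $(b_1,\dots,b_t,u_1,\dots,u_{t-1})$; the signal is $h_t=sig(a_0,b_t,u_t)$; and the behavior profiles satisfy $P(b_{t+1}=b'\mid b_t,\dots,b_1;u_t,\dots,u_1)=M^*_{h_t}(b_t,b')$. The law of $b_1$ is arbitrary. Let $Q$ be the one-step transition matrix on $\mathcal{B}\times\mathcal{B}\times\mathcal{H}$ of the Markov chain $(b_{t+1},b_t,h_t)$, i.e. $Q\big((c,b,h),(c',b',h')\big)=\mathbf 1\{b'=c\}\,\nu\{u: sig(a_0,c,u)=h'\}\,M^*_{h'}(c,c')$. The estimator from $T_1$ observed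 transitions is $$\hat M_{T_1,h}(b,b')=\frac{\sum_{t=1}^{T_1}\mathbf 1\{b_{t+1}=b',\,b_t=b,\,h_t=h\}}{\sum_{t=1}^{T_1}\mathbf 1\{b_t=b,\,h_t=h\}}\qquad(0/0:=0),$$ and for $D=(D_h)_{h\in\mathcal{H}}$ put $\|D\|_\infty=\max_{h\in\mathcal{H},\,b\in\mathcal{B}}\sum_{b'\in\mathcal{B}}|D_h(b,b')|$. Then there is a constant $C_2>0$, depending only on $(\mathcal{B},\mathcal{H},\mathcal{U},\nu,sig,a_0,M^*)$, such that the following holds for every integer $N_0\ge 1$ for which all entries of $Q^{N_0}$ are positive, with $\delta_0>0$ the smallest entry of $Q^{N_0}$, and every $\epsilon>0$. For every process as above and every $T_1>\dfrac{2N_0(|\mathcal{B}|+1)}{|\mathcal{B}||\mathcal{H}|\delta_0C_2\epsilon}$, $$P\big(\|\hat M_{T_1}-M^*\|_\infty\ge\epsilon\big)\le 2|\mathcal{H}||\mathcal{B}|^2(|\mathcal{B}|+1)\exp\Big(-\frac{\big(C_2T_1\delta_0|\mathcal{B}||\mathcal{H}|\epsilon-2N_0(|\mathcal{B}|+1)\big)^2}{2T_1N_0^2(|\mathcal{B}|+1)^2}\Big).$$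 Moreover, as $T_1\to\infty$ with everything else fixed, the right-hand side is $O\big(e^{-cT_1}\big)$ with $c=\dfrac{(C_2\delta_0|\mathcal{B}||\mathcal{H}|\epsilon)^2}{2N_0^2(|\mathcal{B}|+1)^2}>0$. -/

import Mathlib

open MeasureTheory ProbabilityTheory Filter Asymptotics

-- `‖·‖` on matrices is the norm `‖·‖_∞` (maximal absolute row sum); on a finite family of matrices
-- it is then the maximum over the family.
attribute [local instance] Matrix.linftyOpNormedAddCommGroup

namespace BehaviorLearning

noncomputable section

/-- The σ-algebra generated by `X 0, …, X (n - 1)`. -/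
@[reducible] def history {Ω E : Type*} [MeasurableSpace E] (X : ℕ → Ω → E) (n : ℕ) : MeasurableSpace Ω :=
  ⨆ s : ℕ, ⨆ _ : s < n, MeasurableSpace.comap (X s) inferInstance

/-- Behaviour profiles `b t` and users `u t` (periods are numbered from `0`) under a fixed mechanism
with signal function `sig`: in period `t` a user with law `ν` arrives, independently of everything
that happened before, the signal `sig (b t) (u t)` is issued, and the next behaviour profile is drawn
from the row `b t` of the transition matrix `M` of that signal. The law of `b 0` is arbitrary. -/
structure IsBehaviorProcess {Ω B H U : Type*} [MeasurableSpace Ω] [MeasurableSpace B]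
    [MeasurableSpace U] (P : Measure Ω) (ν : Measure U) (sig : B → U → H) (M : H → Matrix B B ℝ)
    (b : ℕ → Ω → B) (u : ℕ → Ω → U) : Prop where
  measurable_behavior : ∀ t, Measurable (b t)
  measurable_user : ∀ t, Measurable (u t)
  law_user : ∀ t, P.map (u t) = ν
  indep_user : ∀ t, Indep (MeasurableSpace.comap (u t) inferInstance)
    (history b (t + 1) ⊔ history u t) P
  markov : ∀ t b', P⟦b (t + 1) ⁻¹' {b'} | history b (t + 1) ⊔ history u (t + 1)⟧
    =ᵐ[P] fun ω => M (sig (b t ω) (u t ω)) (b t ω) b'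

/-- One-step transition matrix of the chain `(b (t + 1), b t, h t)`, where `h t = sig (b t) (u t)`. -/
def tripleChain {B H U : Type*} [DecidableEq B] [MeasurableSpace U] (ν : Measure U)
    (sig : B → U → H) (M : H → Matrix B B ℝ) : Matrix (B × B × H) (B × B × H) ℝ :=
  Matrix.of fun x y =>
    if y.2.1 = x.1 then ν.real {v | sig x.1 v = y.2.2} * M y.2.2 x.1 y.1 else 0

/-- Smallest entry of a (finite, nonempty) matrix. -/
def minEntry {S : Type*} (Q : Matrix S S ℝ) : ℝ := ⨅ p : S × S, Q p.1 p.2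

/-- Conditional frequency estimator of the transition matrices from `T` transitions. A row
`(h, i)` that was never visited is estimated by zero (`0 / 0 = 0`). -/
def freqEstimator {B H : Type*} [DecidableEq B] [DecidableEq H] (b : ℕ → B) (h : ℕ → H) (T : ℕ) :
    H → Matrix B B ℝ := fun j => Matrix.of fun i k =>
  (∑ t ∈ Finset.range T, if b (t + 1) = k ∧ b t = i ∧ h t = j then (1 : ℝ) else 0) /
    (∑ t ∈ Finset.range T, if b t = i ∧ h t = j then (1 : ℝ) else 0)

/-- The tail bound, for `nB` behaviour profiles and `nH` signals. -/
def tailBound (nB nH N₀ : ℕ) (δ₀ C₂ ε : ℝ) (T : ℕ) : ℝ :=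
  2 * nH * nB ^ 2 * (nB + 1) *
    Real.exp (-((C₂ * T * δ₀ * nB * nH * ε - 2 * N₀ * (nB + 1)) ^ 2 /
      (2 * T * N₀ ^ 2 * (nB + 1) ^ 2)))

end

end BehaviorLearning

/-!
The error of the estimator in a fixed entry, multiplied by the number of visits to the pair of
profile `i` and signal `j`, is a sum of martingale differences in `[-1, 1]`, by the Markov property
(`freqEstimator_sub_mul_sum_visit`, `IsBehaviorProcess.condExp_noise`). The estimator can therefore
only be wrong by `ε` in norm if this sum is at least of order `ε * T`, or if the pair was visited
much less often than `T` times (`setOf_le_norm_freqEstimator_sub_subset`).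

Some power of the transition matrix of the triples is positive only if every transition and every
signal has positive probability (`pos_of_tripleChain_pow_pos`). Let `α` be a lower bound for the
products of these probabilities. As a fresh user is independent of the past, each pair is visited
in the next period with conditional probability at least `α`
(`IsBehaviorProcess.condExp_visit_succ`), so rare visits again mean a large sum of increments whose
conditional means are nonpositive. Azuma's inequality (`measureReal_le_sum_range_le`) and a union
bound give a deviation probability of order `exp (-(γ * ε) ^ 2 * T / 2)`, where `γ` is a multiple
of `α`.

It remains to choose `C₂` so small that `C₂ * δ₀ * |B| * |H| ≤ γ`, which is possible independently
of `N₀` because `δ₀ ≤ 1`. Beyond the threshold on `T`, the quantity that is squared in the exponent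
of the tail bound is nonnegative, so dropping its subtracted term only strengthens the bound
(`exp_le_tailBound`).
-/

namespace BehaviorLearning

/-! ### Azuma's inequality -/

/-- The chord of `x ↦ exp (l * x)` over `[-1, 1]` lies above the graph. -/
theorem exp_mul_le_cosh_add_mul_sinh (l : ℝ) {x : ℝ} (hx : |x| ≤ 1) :
    Real.exp (l * x) ≤ Real.cosh l + x * Real.sinh l := by
  obtain ⟨h1, h2⟩ := abs_le.1 hx
  have h := convexOn_exp.2 (Set.mem_univ l) (Set.mem_univ (-l))
    (show (0 : ℝ) ≤ (1 + x) / 2 by linarith) (show (0 : ℝ) ≤ (1 - x) / 2 by linarith) (by ring)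
  simp only [smul_eq_mul] at h
  have e : (1 + x) / 2 * l + (1 - x) / 2 * -l = l * x := by ring
  rw [e] at h
  rw [Real.cosh_eq, Real.sinh_eq]
  linarith

theorem integrable_of_abs_le {Ω : Type*} {mΩ : MeasurableSpace Ω} {P : Measure Ω}
    [IsFiniteMeasure P] {f : Ω → ℝ} (hf : Measurable f) (C : ℝ) (hC : ∀ ω, |f ω| ≤ C) :
    Integrable f P :=
  Integrable.of_bound hf.aestronglyMeasurable C (ae_of_all _ hC)

section Azuma

variable {Ω : Type*} {mΩ : MeasurableSpace Ω} {P : Measure Ω} [IsProbabilityMeasure P]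
  {𝓕 : Filtration ℕ mΩ} {X : ℕ → Ω → ℝ}

theorem measurable_sum_range_of_adapted (hX : ∀ n, Measurable[𝓕 (n + 1)] (X n)) (n : ℕ) :
    Measurable[𝓕 n] fun ω => ∑ t ∈ Finset.range n, X t ω :=
  Finset.measurable_fun_sum _ fun t ht =>
    (hX t).mono (𝓕.mono (Finset.mem_range.1 ht)) le_rfl

theorem abs_sum_range_le (hb : ∀ n ω, |X n ω| ≤ 1) (n : ℕ) (ω : Ω) :
    |∑ t ∈ Finset.range n, X t ω| ≤ n := by
  refine (Finset.abs_sum_le_sum_abs _ _).trans ?_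
  simpa using Finset.sum_le_sum fun t (_ : t ∈ Finset.range n) => hb t ω

theorem abs_exp_mul_sum_range_le (hb : ∀ n ω, |X n ω| ≤ 1) {l : ℝ} (hl : 0 ≤ l) (n : ℕ) (ω : Ω) :
    |Real.exp (l * ∑ t ∈ Finset.range n, X t ω)| ≤ Real.exp (l * n) := by
  rw [abs_of_pos (Real.exp_pos _)]
  exact Real.exp_le_exp.2
    (mul_le_mul_of_nonneg_left (le_of_abs_le (abs_sum_range_le hb n ω)) hl)

theorem integrable_exp_mul_sum_range (hX : ∀ n, Measurable[𝓕 (n + 1)] (X n))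
    (hb : ∀ n ω, |X n ω| ≤ 1) {l : ℝ} (hl : 0 ≤ l) (n : ℕ) :
    Integrable (fun ω => Real.exp (l * ∑ t ∈ Finset.range n, X t ω)) P :=
  integrable_of_abs_le
    ((((measurable_sum_range_of_adapted hX n).mono (𝓕.le n) le_rfl).const_mul l).exp)
    _ (abs_exp_mul_sum_range_le hb hl n)

/-- Exponential moments of a sum of increments in `[-1, 1]` with nonpositive conditional means. -/
theorem integral_exp_mul_sum_range_le (hX : ∀ n, Measurable[𝓕 (n + 1)] (X n))
    (hb : ∀ n ω, |X n ω| ≤ 1) (hc : ∀ n, P[X n | 𝓕 n] ≤ᵐ[P] 0) {l : ℝ} (hl : 0 ≤ l) (n : ℕ) :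
    ∫ ω, Real.exp (l * ∑ t ∈ Finset.range n, X t ω) ∂P ≤ Real.exp (n * (l ^ 2 / 2)) := by
  induction n with
  | zero => simp
  | succ n ih =>
    set Y : Ω → ℝ := fun ω => Real.exp (l * ∑ t ∈ Finset.range n, X t ω) with hY
    have hYm : Measurable[𝓕 n] Y := ((measurable_sum_range_of_adapted hX n).const_mul l).exp
    have hXm : Measurable (X n) := (hX n).mono (𝓕.le _) le_rfl
    have hYi : Integrable Y P := integrable_exp_mul_sum_range hX hb hl n
    have hXi : Integrable (X n) P := integrable_of_abs_le hXm 1 (hb n)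
    have hYX : Integrable (Y * X n) P := by
      refine integrable_of_abs_le ((hYm.mono (𝓕.le n) le_rfl).mul hXm) (Real.exp (l * n) * 1) ?_
      intro ω
      rw [Pi.mul_apply, abs_mul]
      exact mul_le_mul (abs_exp_mul_sum_range_le hb hl n ω) (hb n ω) (abs_nonneg _)
        (Real.exp_pos _).le
    have hneg : ∫ ω, (Y * X n) ω ∂P ≤ 0 := by
      rw [← integral_condExp (𝓕.le n)]
      refine integral_nonpos_of_ae ?_
      filter_upwards [condExp_mul_of_stronglyMeasurable_left hYm.stronglyMeasurable hYX hXi, hc n]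
        with ω h1 h2
      rw [h1]
      exact mul_nonpos_of_nonneg_of_nonpos (Real.exp_pos _).le h2
    calc ∫ ω, Real.exp (l * ∑ t ∈ Finset.range (n + 1), X t ω) ∂P
        ≤ ∫ ω, (Real.cosh l * Y ω + Real.sinh l * (Y * X n) ω) ∂P := by
          refine integral_mono (integrable_exp_mul_sum_range hX hb hl (n + 1))
            ((hYi.const_mul _).add (hYX.const_mul _)) fun ω => ?_
          have h := mul_le_mul_of_nonneg_left (exp_mul_le_cosh_add_mul_sinh l (hb n ω))
            (Real.exp_pos (l * ∑ t ∈ Finset.range n, X t ω)).le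
          rw [← Real.exp_add, ← mul_add, ← Finset.sum_range_succ] at h
          simp only [hY, Pi.mul_apply]
          linarith
      _ = Real.cosh l * ∫ ω, Y ω ∂P + Real.sinh l * ∫ ω, (Y * X n) ω ∂P := by
          rw [integral_add (hYi.const_mul _) (hYX.const_mul _), integral_const_mul,
            integral_const_mul]
      _ ≤ Real.cosh l * ∫ ω, Y ω ∂P := by
          have := mul_nonpos_of_nonneg_of_nonpos (Real.sinh_nonneg_iff.2 hl) hneg
          linarith
      _ ≤ Real.exp (l ^ 2 / 2) * Real.exp (n * (l ^ 2 / 2)) :=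
          mul_le_mul (Real.cosh_le_exp_half_sq l) ih (integral_nonneg fun _ => (Real.exp_pos _).le)
            (Real.exp_pos _).le
      _ = Real.exp ((n + 1 : ℕ) * (l ^ 2 / 2)) := by
          rw [← Real.exp_add]; push_cast; ring_nf

/-- **Azuma's inequality** for increments in `[-1, 1]` with nonpositive conditional means. The
number `n` of increments enters the bound only through an upper bound `N`. -/
theorem measureReal_le_sum_range_le (hX : ∀ n, Measurable[𝓕 (n + 1)] (X n))
    (hb : ∀ n ω, |X n ω| ≤ 1) (hc : ∀ n, P[X n | 𝓕 n] ≤ᵐ[P] 0) {s N : ℝ} (hs : 0 ≤ s)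
    (hN : 0 < N) {n : ℕ} (hn : n ≤ N) :
    P.real {ω | s ≤ ∑ t ∈ Finset.range n, X t ω} ≤ Real.exp (-(s ^ 2 / (2 * N))) := by
  -- the optimal exponent for `N` increments
  set l := s / N
  have hl : 0 ≤ l := div_nonneg hs hN.le
  have h := measure_ge_le_exp_mul_mgf (X := fun ω => ∑ t ∈ Finset.range n, X t ω) s hl
    (integrable_exp_mul_sum_range (P := P) hX hb hl n)
  refine h.trans ?_
  have h2 : mgf (fun ω => ∑ t ∈ Finset.range n, X t ω) P l ≤ Real.exp (N * (l ^ 2 / 2)) :=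
    (integral_exp_mul_sum_range_le hX hb hc hl n).trans
      (Real.exp_le_exp.2 (mul_le_mul_of_nonneg_right hn (by positivity)))
  refine (mul_le_mul_of_nonneg_left h2 (Real.exp_pos _).le).trans (le_of_eq ?_)
  rw [← Real.exp_add]
  congr 1
  simp only [l]
  field_simp
  ring

end Azuma

/-! ### The martingales of the process -/

section Visits

variable {Ω B H U : Type*} [DecidableEq B] [DecidableEq H] {sig : B → U → H}
  {M : H → Matrix B B ℝ} {b : ℕ → Ω → B} {u : ℕ → Ω → U}

/-- The indicator of the event that profile `i` receives signal `j` in period `t`. -/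
noncomputable def visit (sig : B → U → H) (b : ℕ → Ω → B)
    (u : ℕ → Ω → U) (i : B) (j : H) (t : ℕ) (ω : Ω) : ℝ :=
  if b t ω = i ∧ sig (b t ω) (u t ω) = j then 1 else 0

/-- The difference between the indicator of a transition to `k` under the pair `(i, j)` and its
conditional expectation. -/
noncomputable def noise (sig : B → U → H) (M : H → Matrix B B ℝ)
    (b : ℕ → Ω → B) (u : ℕ → Ω → U) (i : B) (j : H) (k : B) (t : ℕ) (ω : Ω) : ℝ :=
  visit sig b u i j t ω * ((b (t + 1) ⁻¹' {k}).indicator (fun _ => (1 : ℝ)) ω - M j i k)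

theorem visit_eq_mul (i : B) (j : H) (t : ℕ) :
    visit sig b u i j t = (b t ⁻¹' {i}).indicator (fun _ => (1 : ℝ)) *
      (u t ⁻¹' (sig i ⁻¹' {j})).indicator (fun _ => (1 : ℝ)) := by
  classical
  ext ω
  rw [Pi.mul_apply, Set.indicator_apply, Set.indicator_apply]
  by_cases h : b t ω = i
  · subst h; simp [visit]
  · simp [visit, h]

theorem visit_nonneg (i : B) (j : H) (t : ℕ) (ω : Ω) : 0 ≤ visit sig b u i j t ω := by
  unfold visit; split_ifs <;> norm_num

theorem visit_le_one (i : B) (j : H) (t : ℕ) (ω : Ω) : visit sig b u i j t ω ≤ 1 := by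
  unfold visit; split_ifs <;> norm_num

theorem abs_noise_le_one {i : B} {j : H} {k : B} (h0 : 0 ≤ M j i k) (h1 : M j i k ≤ 1) (t : ℕ)
    (ω : Ω) : |noise sig M b u i j k t ω| ≤ 1 := by
  classical
  unfold noise
  rw [abs_mul, abs_of_nonneg (visit_nonneg i j t ω)]
  refine mul_le_one₀ (visit_le_one i j t ω) (abs_nonneg _) (abs_le.2 ?_)
  rw [Set.indicator_apply]
  split_ifs <;> constructor <;> linarith

end Visits

section BehaviorProcess

variable {Ω B H U : Type*} {mΩ : MeasurableSpace Ω} [MeasurableSpace B] [MeasurableSpace U]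
  {P : Measure Ω} {ν : Measure U} {sig : B → U → H} {M : H → Matrix B B ℝ} {b : ℕ → Ω → B}
  {u : ℕ → Ω → U}

theorem measurable_history {E : Type*} [MeasurableSpace E] (X : ℕ → Ω → E) {s n : ℕ}
    (hs : s < n) : Measurable[history X n] (X s) :=
  Measurable.of_comap_le (le_iSup₂_of_le s hs le_rfl)

theorem history_le {E : Type*} [MeasurableSpace E] {X : ℕ → Ω → E} (hX : ∀ t, Measurable (X t))
    (n : ℕ) : history X n ≤ mΩ :=
  iSup₂_le fun s _ => (hX s).comap_le

theorem history_mono {E : Type*} [MeasurableSpace E] (X : ℕ → Ω → E) : Monotone (history X) :=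
  fun _ _ h => iSup₂_le fun s hs => le_iSup₂_of_le s (hs.trans_le h) le_rfl

/-- What is known after the signal of period `n` has been issued: the behaviour profiles and users
of the periods `0, …, n`. -/
def IsBehaviorProcess.filtration (hp : IsBehaviorProcess P ν sig M b u) : Filtration ℕ mΩ where
  seq n := history b (n + 1) ⊔ history u (n + 1)
  mono' _ _ h := sup_le_sup (history_mono b (by omega)) (history_mono u (by omega))
  le' n := sup_le (history_le hp.measurable_behavior _) (history_le hp.measurable_user _)

theorem IsBehaviorProcess.measurable_behavior_filtration (hp : IsBehaviorProcess P ν sig M b u)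
    {s n : ℕ} (h : s ≤ n) : Measurable[hp.filtration n] (b s) :=
  (measurable_history b (Nat.lt_succ_of_le h)).mono le_sup_left le_rfl

theorem IsBehaviorProcess.measurable_user_filtration (hp : IsBehaviorProcess P ν sig M b u)
    {s n : ℕ} (h : s ≤ n) : Measurable[hp.filtration n] (u s) :=
  (measurable_history u (Nat.lt_succ_of_le h)).mono le_sup_right le_rfl

/-- What is known in period `t` once the behaviour profile `b t` has been drawn but before the user
`u t` arrives. -/
@[reducible] def beforeUser (b : ℕ → Ω → B) (u : ℕ → Ω → U) (t : ℕ) : MeasurableSpace Ω :=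
  history b (t + 1) ⊔ history u t

variable [MeasurableSingletonClass B] [DecidableEq B] [MeasurableSpace H]
  [MeasurableSingletonClass H] [DecidableEq H]

theorem IsBehaviorProcess.measurable_visit (hp : IsBehaviorProcess P ν sig M b u)
    (hsig : ∀ c, Measurable (sig c)) (i : B) (j : H) {t n : ℕ} (h : t ≤ n) :
    Measurable[hp.filtration n] (visit sig b u i j t) := by
  rw [visit_eq_mul]
  exact (measurable_const.indicator
      (hp.measurable_behavior_filtration h (measurableSet_singleton i))).mul
    (measurable_const.indicator
      (hp.measurable_user_filtration h (hsig i (measurableSet_singleton j))))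

theorem IsBehaviorProcess.measurable_noise (hp : IsBehaviorProcess P ν sig M b u)
    (hsig : ∀ c, Measurable (sig c)) (i : B) (j : H) (k : B) (t : ℕ) :
    Measurable[hp.filtration (t + 1)] (noise sig M b u i j k t) :=
  (hp.measurable_visit hsig i j t.le_succ).mul ((measurable_const.indicator
    (hp.measurable_behavior_filtration le_rfl (measurableSet_singleton k))).sub measurable_const)

variable [IsProbabilityMeasure P]

/-- The Markov property: the noise is a martingale difference sequence. -/
theorem IsBehaviorProcess.condExp_noise (hp : IsBehaviorProcess P ν sig M b u)
    (hsig : ∀ c, Measurable (sig c)) (i : B) (j : H) (k : B) (t : ℕ) :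
    P[noise sig M b u i j k t | hp.filtration t] =ᵐ[P] 0 := by
  have hk : MeasurableSet (b (t + 1) ⁻¹' {k}) :=
    hp.measurable_behavior _ (measurableSet_singleton k)
  have hind : Integrable ((b (t + 1) ⁻¹' {k}).indicator (fun _ => (1 : ℝ))) P :=
    (integrable_const 1).indicator hk
  have hconst : Integrable (fun _ : Ω => M j i k) P := integrable_const _
  have h1 := condExp_stronglyMeasurable_mul_of_bound (hp.filtration.le t)
    (hp.measurable_visit hsig i j le_rfl).stronglyMeasurable (hind.sub hconst) 1
    (ae_of_all _ fun ω => by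
      rw [Real.norm_of_nonneg (visit_nonneg i j t ω)]; exact visit_le_one i j t ω)
  filter_upwards [h1, condExp_sub hind hconst (hp.filtration t), hp.markov t k] with ω e1 e2 e3
  refine e1.trans ?_
  rw [Pi.mul_apply, e2, Pi.sub_apply, condExp_const (hp.filtration.le t)]
  simp only [Pi.zero_apply]
  have e3' : P[(b (t + 1) ⁻¹' {k}).indicator (fun _ => (1 : ℝ)) | hp.filtration t] ω =
    M (sig (b t ω) (u t ω)) (b t ω) k := e3
  rw [e3']
  unfold visit
  split_ifs with h
  · rw [h.2, h.1]; ring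
  · ring

/-- Given the past, the next period shows profile `i` with the transition probability to `i`, and
then signal `j` with the probability that a fresh user triggers it. -/
theorem IsBehaviorProcess.condExp_visit_succ (hp : IsBehaviorProcess P ν sig M b u)
    (hsig : ∀ c, Measurable (sig c)) (i : B) (j : H) (t : ℕ) :
    P[visit sig b u i j (t + 1) | hp.filtration t] =ᵐ[P]
      fun ω => M (sig (b t ω) (u t ω)) (b t ω) i * ν.real (sig i ⁻¹' {j}) := by
  have hGle : beforeUser b u (t + 1) ≤ mΩ :=
    sup_le (history_le hp.measurable_behavior _) (history_le hp.measurable_user _)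
  have hFG : hp.filtration t ≤ beforeUser b u (t + 1) :=
    sup_le_sup_right (history_mono b (by omega)) _
  have hJ : MeasurableSet (sig i ⁻¹' {j}) := hsig i (measurableSet_singleton j)
  set f : Ω → ℝ := (b (t + 1) ⁻¹' {i}).indicator (fun _ => (1 : ℝ)) with hf
  set g : Ω → ℝ := (u (t + 1) ⁻¹' (sig i ⁻¹' {j})).indicator (fun _ => (1 : ℝ)) with hg
  have hfm : Measurable[beforeUser b u (t + 1)] f := measurable_const.indicator
    (((measurable_history b (n := t + 2) (by omega)).mono
      (le_sup_left : _ ≤ beforeUser b u (t + 1)) le_rfl)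
      (measurableSet_singleton i))
  have hfi : Integrable f P := (integrable_const 1).indicator
    (hp.measurable_behavior _ (measurableSet_singleton i))
  have hgi : Integrable g P := (integrable_const 1).indicator (hp.measurable_user _ hJ)
  have hgm : Measurable[MeasurableSpace.comap (u (t + 1)) inferInstance] g :=
    measurable_const.indicator ⟨_, hJ, rfl⟩
  have hint : ∫ ω, g ω ∂P = ν.real (sig i ⁻¹' {j}) := by
    rw [hg, integral_indicator_const _ (hp.measurable_user _ hJ), ← hp.law_user (t + 1),
      map_measureReal_apply (hp.measurable_user _) hJ]
    simp
  have h1 : P[visit sig b u i j (t + 1) | beforeUser b u (t + 1)] =ᵐ[P]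
      fun ω => ν.real (sig i ⁻¹' {j}) * f ω := by
    rw [visit_eq_mul]
    have e1 := condExp_stronglyMeasurable_mul_of_bound hGle hfm.stronglyMeasurable hgi 1
      (ae_of_all _ fun ω => by
        classical rw [hf, Set.indicator_apply]; split_ifs <;> simp)
    have e2 := condExp_indep_eq (hp.measurable_user (t + 1)).comap_le hGle
      hgm.stronglyMeasurable (hp.indep_user (t + 1))
    filter_upwards [e1, e2] with ω e1 e2
    rw [e1, Pi.mul_apply, e2, hint, mul_comm]
  have h2 : P[fun ω => ν.real (sig i ⁻¹' {j}) * f ω | hp.filtration t] =ᵐ[P]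
      fun ω => ν.real (sig i ⁻¹' {j}) * P[f | hp.filtration t] ω :=
    condExp_smul (ν.real (sig i ⁻¹' {j})) f (hp.filtration t)
  filter_upwards [condExp_condExp_of_le (f := visit sig b u i j (t + 1)) (μ := P) hFG hGle,
    condExp_congr_ae (m := hp.filtration t) h1, h2, hp.markov t i] with ω e1 e2 e3 e4
  have e4' : P[f | hp.filtration t] ω = M (sig (b t ω) (u t ω)) (b t ω) i := e4
  rw [← e1, e2, e3, e4', mul_comm]

end BehaviorProcess

/-! ### Concentration of the estimator -/

/-- A family of matrices of norm at least `ε` has an entry of size at least `ε / |B|`. -/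
theorem exists_div_card_le_abs_of_le_norm {B H : Type*} [Fintype B]
    [Fintype H] [Nonempty B] {D : H → Matrix B B ℝ} {ε : ℝ}
    (hε : 0 < ε) (h : ε ≤ ‖D‖) : ∃ j i k, ε / Fintype.card B ≤ |D j i k| := by
  by_contra! hc
  refine absurd h (not_le.2 ((pi_norm_lt_iff hε).2 fun j => ?_))
  rw [Matrix.linfty_opNorm_def]
  have hlt : (Finset.univ.sup fun i => ∑ k, ‖D j i k‖₊) < ε.toNNReal := by
    rw [Finset.sup_lt_iff (by simpa using hε)]
    intro i _
    rw [Real.lt_toNNReal_iff_coe_lt, NNReal.coe_sum]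
    calc ∑ k, ((‖D j i k‖₊ : NNReal) : ℝ) < ∑ _k : B, ε / Fintype.card B :=
          Finset.sum_lt_sum_of_nonempty Finset.univ_nonempty fun k _ => by simpa using hc j i k
      _ = ε := by
          rw [Finset.sum_const, Finset.card_univ, nsmul_eq_mul]
          field_simp
  rwa [Real.lt_toNNReal_iff_coe_lt] at hlt

section Estimator

variable {B H U : Type*} [DecidableEq B] [DecidableEq H]

theorem abs_freqEstimator_sub_le_one [Fintype B] {M : H → Matrix B B ℝ}
    (hM : ∀ h, M h ∈ Matrix.rowStochastic ℝ B) (b : ℕ → B) (h : ℕ → H) (T : ℕ) (j : H) (i k : B) :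
    |(freqEstimator b h T - M) j i k| ≤ 1 := by
  have h0 : 0 ≤ M j i k := Matrix.nonneg_of_mem_rowStochastic (hM j)
  have h1 : M j i k ≤ 1 := Matrix.le_one_of_mem_rowStochastic (hM j)
  have e0 : 0 ≤ freqEstimator b h T j i k :=
    div_nonneg (Finset.sum_nonneg fun t _ => by split_ifs <;> norm_num)
      (Finset.sum_nonneg fun t _ => by split_ifs <;> norm_num)
  have e1 : freqEstimator b h T j i k ≤ 1 := by
    refine div_le_one_of_le₀ (Finset.sum_le_sum fun t _ => ?_)
      (Finset.sum_nonneg fun t _ => by split_ifs <;> norm_num)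
    split_ifs with h1 h2
    · exact le_rfl
    · exact absurd h1.2 h2
    · exact zero_le_one
    · exact le_rfl
  change |freqEstimator b h T j i k - M j i k| ≤ 1
  rw [abs_le]
  constructor <;> linarith

/-- The error of the estimator, multiplied by the number of visits, is a sum of martingale
differences. An unvisited row is no exception, since its differences all vanish. -/
theorem freqEstimator_sub_mul_sum_visit {Ω : Type*} (sig : B → U → H) (M : H → Matrix B B ℝ)
    (b : ℕ → Ω → B) (u : ℕ → Ω → U) (T : ℕ) (i : B) (j : H) (k : B) (ω : Ω) :
    (freqEstimator (fun t => b t ω) (fun t => sig (b t ω) (u t ω)) T - M) j i k *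
        ∑ t ∈ Finset.range T, visit sig b u i j t ω =
      ∑ t ∈ Finset.range T, noise sig M b u i j k t ω := by
  classical
  set N := ∑ t ∈ Finset.range T, visit sig b u i j t ω with hN
  set K := ∑ t ∈ Finset.range T,
    visit sig b u i j t ω * (b (t + 1) ⁻¹' {k}).indicator (fun _ => (1 : ℝ)) ω with hK
  have h1 : ∑ t ∈ Finset.range T, noise sig M b u i j k t ω = K - N * M j i k := by
    simp only [noise, mul_sub, Finset.sum_sub_distrib, hK, hN, Finset.sum_mul]
  have h2 : freqEstimator (fun t => b t ω) (fun t => sig (b t ω) (u t ω)) T j i k = K / N := by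
    refine congrArg (fun x : ℝ => x / N) (Finset.sum_congr rfl fun t _ => ?_)
    by_cases hk : b (t + 1) ω = k
    · simp [visit, hk]
    · simp [hk]
  have h3 : N = 0 → K = 0 := fun h0 => Finset.sum_eq_zero fun t ht => by
    rw [(Finset.sum_eq_zero_iff_of_nonneg fun t _ => visit_nonneg i j t ω).1 h0 t ht, zero_mul]
  rw [h1]
  change (freqEstimator _ _ T j i k - M j i k) * N = _
  rw [h2, sub_mul, mul_comm N]
  by_cases h0 : N = 0
  · rw [h0, h3 h0]; simp
  · rw [div_mul_cancel₀ _ h0]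

/-- A large error of the estimator means either that some pair `(i, j)` was visited rarely, or that
some sum of martingale differences is large. -/
theorem setOf_le_norm_freqEstimator_sub_subset {Ω : Type*} [Fintype B] [Fintype H] [Nonempty B]
    {sig : B → U → H} {M : H → Matrix B B ℝ} {b : ℕ → Ω → B} {u : ℕ → Ω → U} {α ε : ℝ}
    (hα : 0 < α) (hε : 0 < ε) (n : ℕ) (hn : 1 ≤ n) :
    {ω | ε ≤ ‖freqEstimator (fun t => b t ω) (fun t => sig (b t ω) (u t ω)) (n + 1) - M‖} ⊆
      ⋃ p : H × B, ({ω | α * (n + 1) / 4 ≤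
          ∑ t ∈ Finset.range n, (α - visit sig b u p.2 p.1 (t + 1) ω)} ∪
        ⋃ k : B, ({ω | ε / Fintype.card B * (α * (n + 1) / 4) ≤
            ∑ t ∈ Finset.range (n + 1), noise sig M b u p.2 p.1 k t ω} ∪
          {ω | ε / Fintype.card B * (α * (n + 1) / 4) ≤
            ∑ t ∈ Finset.range (n + 1), -noise sig M b u p.2 p.1 k t ω})) := by
  intro ω hω
  obtain ⟨j, i, k, hd⟩ := exists_div_card_le_abs_of_le_norm hε hω
  have hn' : (1 : ℝ) ≤ n := by exact_mod_cast hn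
  refine Set.mem_iUnion.2 ⟨(j, i), ?_⟩
  rcases le_or_gt (α * (n + 1) / 4) (∑ t ∈ Finset.range (n + 1), visit sig b u i j t ω)
    with h | h
  · refine Or.inr (Set.mem_iUnion.2 ⟨k, ?_⟩)
    have habs : ε / Fintype.card B * (α * (n + 1) / 4) ≤
        |∑ t ∈ Finset.range (n + 1), noise sig M b u i j k t ω| := by
      rw [← freqEstimator_sub_mul_sum_visit, abs_mul]
      exact mul_le_mul hd (h.trans (le_abs_self _)) (by positivity) (abs_nonneg _)
    rcases le_abs.1 habs with h' | h'
    · exact Or.inl h'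
    · refine Or.inr ?_
      rw [Set.mem_ofPred_eq, Finset.sum_neg_distrib]
      exact h'
  · refine Or.inl ?_
    rw [Finset.sum_range_succ'] at h
    have h0 := visit_nonneg (sig := sig) (b := b) (u := u) i j 0 ω
    rw [Set.mem_ofPred_eq, Finset.sum_sub_distrib, Finset.sum_const, Finset.card_range,
      nsmul_eq_mul]
    nlinarith

end Estimator

section Deviation

variable {Ω B H U : Type*} {mΩ : MeasurableSpace Ω} [MeasurableSpace B] [MeasurableSpace U]
  [Fintype B] [MeasurableSingletonClass B] [DecidableEq B] [Fintype H] [MeasurableSpace H]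
  [MeasurableSingletonClass H] [DecidableEq H]
  {P : Measure Ω} [IsProbabilityMeasure P] {ν : Measure U} {sig : B → U → H}
  {M : H → Matrix B B ℝ} {b : ℕ → Ω → B} {u : ℕ → Ω → U}

/-- The deviation bound for the estimator when every product of a transition probability and a
signal probability is at least `α`: the number of visits to any pair is then at least of order
`α * T`, and Azuma's inequality controls the rare visits and both signs of the noise. -/
theorem IsBehaviorProcess.measureReal_le_norm_freqEstimator_sub_le
    (hp : IsBehaviorProcess P ν sig M b u) (hsig : ∀ c, Measurable (sig c))
    (hM : ∀ h, M h ∈ Matrix.rowStochastic ℝ B) {α : ℝ} (hα : 0 < α) (hα1 : α ≤ 1)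
    (hαM : ∀ j i k j', α ≤ M j i k * ν.real (sig k ⁻¹' {j'})) {ε : ℝ} (hε : 0 < ε)
    (hεB : ε ≤ Fintype.card B) {T : ℕ} (hT : 2 ≤ T) :
    P.real {ω | ε ≤ ‖freqEstimator (fun t => b t ω) (fun t => sig (b t ω) (u t ω)) T - M‖} ≤
      Fintype.card H * Fintype.card B * (1 + 2 * Fintype.card B) *
        Real.exp (-((α / (8 * (Fintype.card B + 1)) * ε) ^ 2 * T / 2)) := by
  obtain ⟨n, rfl⟩ : ∃ n, T = n + 1 := ⟨T - 1, by omega⟩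
  have hBpos : (0 : ℝ) < Fintype.card B := hε.trans_le hεB
  have : Nonempty B := Fintype.card_pos_iff.1 (by exact_mod_cast hBpos)
  push_cast
  set β : ℝ := ((Fintype.card B : ℕ) : ℝ) with hβ
  set E := Real.exp (-((α / (8 * (β + 1)) * ε) ^ 2 * ((n : ℝ) + 1) / 2)) with hE
  have hN : (0 : ℝ) < (n : ℝ) + 1 := by positivity
  have hr : α / (8 * (β + 1)) * ε ≤ ε / β * (α / 4) := by
    rw [div_mul_eq_mul_div, div_mul_div_comm, div_le_div_iff₀ (by positivity) (by positivity)]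
    nlinarith [mul_pos hα hε, mul_pos (mul_pos hα hε) hBpos]
  have hr' : α / (8 * (β + 1)) * ε ≤ α / 4 := by
    refine hr.trans (mul_le_of_le_one_left (by positivity) ((div_le_one hBpos).2 hεB))
  have tail : ∀ {s q : ℝ}, s = q * (n + 1) → α / (8 * (β + 1)) * ε ≤ q →
      Real.exp (-(s ^ 2 / (2 * ((n : ℝ) + 1)))) ≤ E := by
    intro s q hs hq
    refine Real.exp_le_exp.2 (neg_le_neg ?_)
    have hsq : s ^ 2 / (2 * ((n : ℝ) + 1)) = q ^ 2 * (n + 1) / 2 := by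
      rw [hs]; field_simp
    rw [hsq]
    gcongr
  have bound : ∀ (j : H) (i k : B), 0 ≤ M j i k ∧ M j i k ≤ 1 := fun j i k =>
    ⟨Matrix.nonneg_of_mem_rowStochastic (hM j), Matrix.le_one_of_mem_rowStochastic (hM j)⟩
  have rare : ∀ i j, P.real {ω | α * (n + 1) / 4 ≤
      ∑ t ∈ Finset.range n, (α - visit sig b u i j (t + 1) ω)} ≤ E := by
    intro i j
    refine (measureReal_le_sum_range_le (𝓕 := hp.filtration)
      (X := fun t ω => α - visit sig b u i j (t + 1) ω)
      (fun t => measurable_const.sub (hp.measurable_visit hsig i j le_rfl)) (fun t ω => ?_)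
      (fun t => ?_) (by positivity) hN (by linarith)).trans (tail (q := α / 4) (by ring) hr')
    · have h0 := visit_nonneg (sig := sig) (b := b) (u := u) i j (t + 1) ω
      have h1 := visit_le_one (sig := sig) (b := b) (u := u) i j (t + 1) ω
      exact abs_le.2 ⟨by linarith, by linarith⟩
    · have hv : Integrable (visit sig b u i j (t + 1)) P :=
        integrable_of_abs_le
          ((hp.measurable_visit hsig i j le_rfl).mono (hp.filtration.le (t + 1)) le_rfl) 1
          fun ω => by rw [abs_of_nonneg (visit_nonneg i j _ ω)]; exact visit_le_one i j _ ω
      filter_upwards [condExp_sub (integrable_const α) hv (hp.filtration t),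
        hp.condExp_visit_succ hsig i j t] with ω e1 e2
      refine e1.trans_le ?_
      rw [Pi.sub_apply, condExp_const (hp.filtration.le t), e2]
      exact sub_nonpos.2 (hαM _ _ _ _)
  have up : ∀ i j k, P.real {ω | ε / β * (α * (n + 1) / 4) ≤
      ∑ t ∈ Finset.range (n + 1), noise sig M b u i j k t ω} ≤ E := fun i j k =>
    (measureReal_le_sum_range_le (fun t => hp.measurable_noise hsig i j k t)
      (fun t ω => abs_noise_le_one (bound j i k).1 (bound j i k).2 t ω)
      (fun t => (hp.condExp_noise hsig i j k t).le) (by positivity) hN (by push_cast; rfl)).trans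
      (tail (q := ε / β * (α / 4)) (by ring) hr)
  have down : ∀ i j k, P.real {ω | ε / β * (α * (n + 1) / 4) ≤
      ∑ t ∈ Finset.range (n + 1), -noise sig M b u i j k t ω} ≤ E := by
    refine fun i j k => (measureReal_le_sum_range_le (𝓕 := hp.filtration)
      (X := fun t ω => -noise sig M b u i j k t ω)
      (fun t => (hp.measurable_noise hsig i j k t).neg)
      (fun t ω => (abs_neg _).trans_le (abs_noise_le_one (bound j i k).1 (bound j i k).2 t ω))
      (fun t => ?_) (by positivity) hN (by push_cast; rfl)).trans
      (tail (q := ε / β * (α / 4)) (by ring) hr)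
    filter_upwards [condExp_neg (noise sig M b u i j k t) (hp.filtration t),
      hp.condExp_noise hsig i j k t] with ω e1 e2
    refine e1.trans_le ?_
    rw [Pi.neg_apply, e2]
    simp
  refine (measureReal_mono (setOf_le_norm_freqEstimator_sub_subset hα hε n (by omega))).trans ?_
  refine (measureReal_iUnion_fintype_le _).trans ?_
  calc _ ≤ ∑ _p : H × B, (E + ∑ _k : B, (E + E)) := by
        refine Finset.sum_le_sum fun p _ => (measureReal_union_le _ _).trans
          (add_le_add (rare _ _) ((measureReal_iUnion_fintype_le _).trans
            (Finset.sum_le_sum fun k _ => (measureReal_union_le _ _).trans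
              (add_le_add (up _ _ _) (down _ _ _)))))
    _ = _ := by
        simp only [Finset.sum_const, Finset.card_univ, Fintype.card_prod, nsmul_eq_mul,
          Nat.cast_mul, hβ]
        ring

end Deviation

/-! ### The transition matrix of the triples -/

section TripleChain

variable {B H U : Type*} [Fintype B] [DecidableEq B] [Fintype H] [DecidableEq H]
  [MeasurableSpace U] {ν : Measure U}
  {sig : B → U → H} {M : H → Matrix B B ℝ}

theorem tripleChain_mem_rowStochastic [MeasurableSpace H] [MeasurableSingletonClass H]
    [IsProbabilityMeasure ν] (hsig : ∀ c, Measurable (sig c))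
    (hM : ∀ h, M h ∈ Matrix.rowStochastic ℝ B) :
    tripleChain ν sig M ∈ Matrix.rowStochastic ℝ (B × B × H) := by
  rw [Matrix.mem_rowStochastic_iff_sum]
  refine ⟨fun x y => ?_, fun x => ?_⟩
  · simp only [tripleChain, Matrix.of_apply]
    split_ifs
    · exact mul_nonneg measureReal_nonneg (Matrix.nonneg_of_mem_rowStochastic (hM _))
    · exact le_rfl
  · have hν : ∑ h, ν.real {v | sig x.1 v = h} = 1 := by
      have h := sum_measureReal_preimage_singleton (μ := ν) (f := sig x.1) Finset.univ
        (fun h _ => hsig x.1 (measurableSet_singleton h))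
      simpa [Set.preimage] using h
    calc ∑ y, tripleChain ν sig M x y
        = ∑ c, ∑ h, ν.real {v | sig x.1 v = h} * M h x.1 c := by
          simp only [tripleChain, Matrix.of_apply, Fintype.sum_prod_type]
          refine Finset.sum_congr rfl fun c _ => ?_
          rw [Finset.sum_comm]
          simp
      _ = 1 := by
          rw [Finset.sum_comm]
          simp only [← Finset.mul_sum, Matrix.sum_row_of_mem_rowStochastic (hM _), mul_one, hν]

/-- Every column of the transition matrix has a positive entry as soon as some power of it is
positive. Hence all signals and all transitions have positive probability. -/
theorem pos_of_tripleChain_pow_pos (hM : ∀ h, M h ∈ Matrix.rowStochastic ℝ B) {N : ℕ} (hN : 1 ≤ N)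
    (h : ∀ x y, 0 < (tripleChain ν sig M ^ N) x y) (j : H) (i k : B) :
    0 < M j i k ∧ 0 < ν.real (sig i ⁻¹' {j}) := by
  obtain ⟨n, rfl⟩ : ∃ n, N = n + 1 := ⟨N - 1, by omega⟩
  have hy := h (k, i, j) (k, i, j)
  rw [pow_succ, Matrix.mul_apply] at hy
  obtain ⟨z, -, hz⟩ := Finset.exists_ne_zero_of_sum_ne_zero hy.ne'
  have hz' := right_ne_zero_of_mul hz
  simp only [tripleChain, Matrix.of_apply] at hz'
  split_ifs at hz' with hi
  · rw [← hi] at hz'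
    exact ⟨(right_ne_zero_of_mul hz').symm.lt_of_le (Matrix.nonneg_of_mem_rowStochastic (hM j)),
      (left_ne_zero_of_mul hz').symm.lt_of_le measureReal_nonneg⟩
  · exact absurd rfl hz'

end TripleChain

theorem minEntry_le {S : Type*} [Finite S] (Q : Matrix S S ℝ) (x y : S) : minEntry Q ≤ Q x y :=
  ciInf_le (Set.finite_range fun p : S × S => Q p.1 p.2).bddBelow (x, y)

theorem minEntry_pos {S : Type*} [Finite S] [Nonempty S] {Q : Matrix S S ℝ}
    (h : ∀ x y, 0 < Q x y) : 0 < minEntry Q := by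
  obtain ⟨p, hp⟩ := exists_eq_ciInf_of_finite (f := fun p : S × S => Q p.1 p.2)
  exact (h p.1 p.2).trans_eq hp

/-- A lower bound for the positive values of a function on a finite type. -/
theorem exists_pos_forall_le_of_pos {S : Type*} [Finite S] (f : S → ℝ) :
    ∃ α : ℝ, 0 < α ∧ α ≤ 1 ∧ ∀ x, 0 < f x → α ≤ f x := by
  have : Finite (Option S) := inferInstance
  obtain ⟨x, hx⟩ := Finite.exists_min fun o : Option S =>
    o.elim (1 : ℝ) fun s => if 0 < f s then f s else 1
  refine ⟨_, ?_, hx none, fun s hs => ?_⟩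
  · cases x with
    | none => exact one_pos
    | some s => simp only [Option.elim_some]; split_ifs with h; exacts [h, one_pos]
  · simpa [hs] using hx (some s)

/-! ### The tail bound -/

theorem tailBound_nonneg (nB nH N₀ : ℕ) (δ₀ C₂ ε : ℝ) (T : ℕ) :
    0 ≤ tailBound nB nH N₀ δ₀ C₂ ε T := by
  unfold tailBound; positivity

theorem isBigO_tailBound (nB nH : ℕ) {N₀ : ℕ} (hN₀ : 1 ≤ N₀) (δ₀ C₂ ε : ℝ) :
    (fun T : ℕ => tailBound nB nH N₀ δ₀ C₂ ε T) =O[atTop] fun T : ℕ =>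
      Real.exp (-((C₂ * δ₀ * nB * nH * ε) ^ 2 / (2 * N₀ ^ 2 * (nB + 1) ^ 2)) * T) := by
  set a := C₂ * δ₀ * nB * nH * ε with ha
  have hN : (0 : ℝ) < N₀ := by exact_mod_cast hN₀
  set d : ℝ := N₀ * (nB + 1) with hd
  have hd0 : 0 < d := by positivity
  refine IsBigO.of_bound (2 * nH * nB ^ 2 * (nB + 1) * Real.exp (2 * a / d)) ?_
  filter_upwards [eventually_ge_atTop 1] with T hT
  have hT0 : (0 : ℝ) < T := by exact_mod_cast hT
  rw [Real.norm_of_nonneg (tailBound_nonneg _ _ _ _ _ _ _), Real.norm_of_nonneg (Real.exp_pos _).le,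
    mul_assoc _ (Real.exp _), ← Real.exp_add, tailBound]
  refine mul_le_mul_of_nonneg_left (Real.exp_le_exp.2 ?_) (by positivity)
  have e1 : (C₂ * T * δ₀ * nB * nH * ε - 2 * N₀ * (nB + 1)) ^ 2 / (2 * T * N₀ ^ 2 * (nB + 1) ^ 2)
      = a ^ 2 / (2 * d ^ 2) * T - 2 * a / d + 2 / T := by
    rw [show C₂ * T * δ₀ * nB * nH * ε - 2 * N₀ * (nB + 1) = a * T - 2 * d by rw [ha, hd]; ring,
      show 2 * (T : ℝ) * N₀ ^ 2 * (nB + 1) ^ 2 = 2 * T * d ^ 2 by rw [hd]; ring]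
    field_simp
    ring
  have e2 : 2 * (N₀ : ℝ) ^ 2 * (nB + 1) ^ 2 = 2 * d ^ 2 := by rw [hd]; ring
  have e3 : 0 ≤ 2 / (T : ℝ) := by positivity
  rw [e1, e2]
  linarith

/-- Beyond the threshold the subtracted term of the tail bound only weakens it. -/
theorem exp_le_tailBound {nB nH N₀ : ℕ} (hB : 1 ≤ nB) (hN₀ : 1 ≤ N₀) {δ₀ C₂ ε γ : ℝ}
    (hδ₀ : 0 < δ₀) (hC₂ : 0 < C₂) (hε : 0 < ε) (hγ : C₂ * δ₀ * nB * nH ≤ γ) {T : ℕ} (hT0 : 0 < T)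
    (hT : 2 * N₀ * (nB + 1) ≤ C₂ * T * δ₀ * nB * nH * ε) :
    nH * nB * (1 + 2 * nB) * Real.exp (-((γ * ε) ^ 2 * T / 2)) ≤ tailBound nB nH N₀ δ₀ C₂ ε T := by
  have hB' : (1 : ℝ) ≤ nB := by exact_mod_cast hB
  have hN : (1 : ℝ) ≤ N₀ := by exact_mod_cast hN₀
  have hT' : (0 : ℝ) < T := by exact_mod_cast hT0
  unfold tailBound
  refine mul_le_mul ?_ (Real.exp_le_exp.2 (neg_le_neg ?_)) (Real.exp_pos _).le (by positivity)
  · have h : 1 + 2 * (nB : ℝ) ≤ 2 * nB * (nB + 1) := by nlinarith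
    calc (nH : ℝ) * nB * (1 + 2 * nB) ≤ nH * nB * (2 * nB * (nB + 1)) := by gcongr
      _ = _ := by ring
  · have hd : 1 ≤ (N₀ : ℝ) * (nB + 1) := one_le_mul_of_one_le_of_one_le hN (by linarith)
    calc (C₂ * T * δ₀ * nB * nH * ε - 2 * N₀ * (nB + 1)) ^ 2 / (2 * T * N₀ ^ 2 * (nB + 1) ^ 2)
        ≤ (C₂ * T * δ₀ * nB * nH * ε) ^ 2 / (2 * T * N₀ ^ 2 * (nB + 1) ^ 2) := by
          have h0 : (0 : ℝ) ≤ 2 * N₀ * (nB + 1) := by positivity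
          refine div_le_div_of_nonneg_right (pow_le_pow_left₀ ?_ ?_ 2) (by positivity) <;> linarith
      _ = (C₂ * δ₀ * nB * nH * ε) ^ 2 * T / 2 / (N₀ * (nB + 1)) ^ 2 := by
          field_simp
      _ ≤ (C₂ * δ₀ * nB * nH * ε) ^ 2 * T / 2 :=
          div_le_self (by positivity) (one_le_pow₀ hd)
      _ ≤ (γ * ε) ^ 2 * T / 2 := by gcongr

end BehaviorLearning

theorem theorem3 {A B H U : Type*}
    [Fintype B] [DecidableEq B] [MeasurableSpace B] [MeasurableSingletonClass B]
    [Fintype H] [DecidableEq H] [MeasurableSpace H] [MeasurableSingletonClass H]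
    [MeasurableSpace U] (ν : Measure U) [IsProbabilityMeasure ν]
    (sig : A → B → U → H) (a₀ : A) (hsig : ∀ b, Measurable (sig a₀ b))
    (M : H → Matrix B B ℝ) (hM : ∀ h, M h ∈ Matrix.rowStochastic ℝ B) :
    ∃ C₂ : ℝ, 0 < C₂ ∧ ∀ (N₀ : ℕ) (δ₀ : ℝ), 1 ≤ N₀ →
      (∀ x y, 0 < (BehaviorLearning.tripleChain ν (sig a₀) M ^ N₀) x y) →
      δ₀ = BehaviorLearning.minEntry (BehaviorLearning.tripleChain ν (sig a₀) M ^ N₀) →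
      ∀ ε : ℝ, 0 < ε →
        (∀ (Ω : Type*) [MeasurableSpace Ω] (P : Measure Ω) [IsProbabilityMeasure P]
            (b : ℕ → Ω → B) (u : ℕ → Ω → U),
            BehaviorLearning.IsBehaviorProcess P ν (sig a₀) M b u →
            ∀ T : ℕ, (2 * N₀ * (Fintype.card B + 1)) /
                (Fintype.card B * Fintype.card H * δ₀ * C₂ * ε) < (T : ℝ) →
              P.real {ω | ε ≤ ‖BehaviorLearning.freqEstimator (fun t => b t ω)
                  (fun t => sig a₀ (b t ω) (u t ω)) T - M‖} ≤
                BehaviorLearning.tailBound (Fintype.card B) (Fintype.card H) N₀ δ₀ C₂ ε T) ∧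
        (fun T : ℕ =>
            BehaviorLearning.tailBound (Fintype.card B) (Fintype.card H) N₀ δ₀ C₂ ε T)
          =O[atTop] fun T : ℕ => Real.exp (-((C₂ * δ₀ * Fintype.card B * Fintype.card H * ε) ^ 2 /
            (2 * N₀ ^ 2 * (Fintype.card B + 1) ^ 2)) * T) := by
  -- positive values of this product are bounded below, uniformly in `N₀`
  obtain ⟨α, hα, hα1, hαle⟩ := BehaviorLearning.exists_pos_forall_le_of_pos
    fun x : H × B × B × H => M x.1 x.2.1 x.2.2.1 * ν.real (sig a₀ x.2.2.1 ⁻¹' {x.2.2.2})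
  set β : ℝ := ((Fintype.card B : ℕ) : ℝ) with hβ
  set η : ℝ := ((Fintype.card H : ℕ) : ℝ) with hη
  have hβ0 : 0 ≤ β := Nat.cast_nonneg _
  have hη0 : 0 ≤ η := Nat.cast_nonneg _
  set γ := α / (8 * (β + 1)) with hγ
  have hγ0 : 0 < γ := by positivity
  refine ⟨γ / ((β + 1) * (η + 1)), by positivity, ?_⟩
  set C₂ := γ / ((β + 1) * (η + 1)) with hC₂
  have hC₂0 : 0 < C₂ := by positivity
  intro N₀ δ₀ hN₀ hQ hδ₀ ε hε
  refine ⟨?_, BehaviorLearning.isBigO_tailBound _ _ hN₀ _ _ _⟩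
  intro Ω _ P _ b u hp T hT
  by_cases hεB : β < ε
  · -- no entry of the error exceeds `1`, so the event is empty
    have hempty : {ω | ε ≤ ‖BehaviorLearning.freqEstimator (fun t => b t ω)
        (fun t => sig a₀ (b t ω) (u t ω)) T - M‖} = ∅ := by
      refine Set.eq_empty_iff_forall_notMem.2 fun ω hω => ?_
      have : Nonempty B := ⟨b 0 ω⟩
      obtain ⟨j, i, k, h⟩ := BehaviorLearning.exists_div_card_le_abs_of_le_norm hε hω
      have h1 := h.trans (BehaviorLearning.abs_freqEstimator_sub_le_one hM _ _ _ _ _ _)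
      rw [div_le_one (by exact_mod_cast Fintype.card_pos)] at h1
      exact absurd h1 (not_le.2 hεB)
    rw [hempty, measureReal_empty]
    exact BehaviorLearning.tailBound_nonneg _ _ _ _ _ _ _
  rw [not_lt] at hεB
  obtain ⟨ω⟩ := nonempty_of_isProbabilityMeasure P
  have hB : Nonempty B := ⟨b 0 ω⟩
  have hH : Nonempty H := ⟨sig a₀ (b 0 ω) (u 0 ω)⟩
  have hβ1 : 1 ≤ β := by rw [hβ]; exact_mod_cast Fintype.card_pos (α := B)
  have hη1 : 1 ≤ η := by rw [hη]; exact_mod_cast Fintype.card_pos (α := H)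
  have hN₀' : (1 : ℝ) ≤ N₀ := by exact_mod_cast hN₀
  have hδpos : 0 < δ₀ := hδ₀ ▸ BehaviorLearning.minEntry_pos hQ
  have hδ1 : δ₀ ≤ 1 := by
    obtain ⟨x⟩ : Nonempty (B × B × H) := inferInstance
    rw [hδ₀]
    exact (BehaviorLearning.minEntry_le _ x x).trans (Matrix.le_one_of_mem_rowStochastic
      (pow_mem (BehaviorLearning.tripleChain_mem_rowStochastic hsig hM) N₀))
  have hαM : ∀ j i k j', α ≤ M j i k * ν.real (sig a₀ k ⁻¹' {j'}) := fun j i k j' =>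
    hαle (j, i, k, j') (mul_pos (BehaviorLearning.pos_of_tripleChain_pow_pos hM hN₀ hQ j i k).1
      (BehaviorLearning.pos_of_tripleChain_pow_pos hM hN₀ hQ j' k k).2)
  have hCγ : C₂ * δ₀ * β * η ≤ γ := by
    calc C₂ * δ₀ * β * η ≤ C₂ * 1 * (β + 1) * (η + 1) := by gcongr <;> linarith
      _ = γ := by rw [hC₂]; field_simp
  have hT1 : 2 * N₀ * (β + 1) < C₂ * T * δ₀ * β * η * ε := by
    rw [div_lt_iff₀ (by positivity)] at hT
    linarith
  have hT2 : 2 ≤ T := by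
    have hγε : γ * ε ≤ 1 := by
      rw [hγ, div_mul_eq_mul_div, div_le_one (by positivity)]
      calc α * ε ≤ 1 * β := mul_le_mul hα1 hεB hε.le zero_le_one
        _ ≤ 8 * (β + 1) := by linarith
    have h1 : 2 < (T : ℝ) := by
      calc (2 : ℝ) ≤ 2 * N₀ * (β + 1) := by nlinarith
        _ < C₂ * T * δ₀ * β * η * ε := hT1
        _ = C₂ * δ₀ * β * η * ε * T := by ring
        _ ≤ γ * ε * T := by gcongr
        _ ≤ T := mul_le_of_le_one_left (Nat.cast_nonneg _) hγε
    exact_mod_cast h1.le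
  exact (hp.measureReal_le_norm_freqEstimator_sub_le hsig hM hα hα1 hαM hε hεB hT2).trans
    (BehaviorLearning.exp_le_tailBound Fintype.card_pos hN₀ hδpos hC₂0 hε hCγ (by omega) hT1.le)
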